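/- Let $D\ge 0$ and $d$ be natural numbers, and place a quantum system with Hilbert space $\mathbb{C}^d$ on each site of the hypercubic lattice $\mathbb{Z}^D$. A quantum state $\rho$ of the lattice is a family $(\rho_B)$ of density matrices (positive semidefinite, of trace one), $\rho_B$ acting on $\bigotimes_{\beta\in B}\mathbb{C}^d$, indexed by the finite subsets $B\subset\mathbb{Z}^D$, with $\mathrm{tr}_{B\setminus C}(\rho_B)=\rho_C$ whenever $C\subset B$; the $\rho_B$ are its marginals. A density matrix $\sigma$ on finitely many sites $B$ is (fully) separable if there is a probability measure $p$ on families $\phi=(\phi_\beta)_{\beta\in B}$ of unit vectors of $\mathbb{C}^d$ with $$\sigma=\int p(d\phi)\bigotimes_{\beta\in B}|\phi_\beta\rangle\langle\phi_\beta| ,$$ and a state $\rho$ of the lattice is separable if $\rho_B$ is separable for every finite $B$. The state $\rho$ is translation and reflection invariant if, for every translation $g$ of $\mathbb{Z}^D$ and for every axis reflection $g:\ x_k\mapsto c-x_k$ ($1\le k\le D$, $c\in\mathbb{Z}$; the other coordinates fixed), and for every finite $B$, relabelling the tensor factor of each site $\beta\in B$ by $g(\beta)$ turns $\rho_B$ into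 $\rho_{g(B)}$. Let $\hat\rho$ be a density matrix on the sites of the plaquette $\hat I=\{1,2\}^D$. Then there is a separable, translation and reflection invariant state $\rho$ of $\mathbb{Z}^D$ with $\rho_{\hat I}=\hat\rho$ if and only if $\hat\rho$ is fully separable and, for each axis $k=1,\dots,D$, invariant under conjugation by the unitary that permutes the tensor factors according to the reflection $x_k\mapsto 3-x_k$ of $\hat I$. -/

import Mathlib

open scoped ComplexOrder

/-- Operators on `⨂_{a ∈ ι} ℂ^d`, written as matrices in the product basis, whose elements
are the functions `ι → Fin d`. -/
abbrev LocalOp (ι : Type*) (d : ℕ) : Type _ := Matrix (ι → Fin d) (ι → Fin d) ℂ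

/-- Density matrices: positive semidefinite matrices of trace one. -/
def IsDensityMatrix {ι : Type*} [Fintype ι] [DecidableEq ι] {d : ℕ} (M : LocalOp ι d) : Prop :=
  M.PosSemidef ∧ M.trace = 1

/-- Unit vectors of `ℂ^d`. -/
abbrev PureState (d : ℕ) : Type := Metric.sphere (0 : EuclideanSpace ℂ (Fin d)) 1

/-- The product projector `⨂_a |φ_a⟩⟨φ_a|`. -/
noncomputable def productProjector {ι : Type*} [Fintype ι] {d : ℕ} (φ : ι → PureState d) :
    LocalOp ι d :=
  Matrix.of fun i j =>
    ∏ a, (φ a : EuclideanSpace ℂ (Fin d)) (i a) * star ((φ a : EuclideanSpace ℂ (Fin d)) (j a))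

/-- Full separability: `M = ∫ p(dφ) ⨂_a |φ_a⟩⟨φ_a|` for a probability measure `p` on families
of unit vectors. The matrix-valued integral is taken entry by entry; the entries of the integrand
are continuous and bounded by one. -/
def IsFullySeparable {ι : Type*} [Fintype ι] {d : ℕ} (M : LocalOp ι d) : Prop :=
  ∃ p : MeasureTheory.Measure (ι → PureState d), MeasureTheory.IsProbabilityMeasure p ∧
    ∀ i j, M i j = ∫ φ, productProjector φ i j ∂p

/-- Transport of an operator along a bijection of the sites: the tensor factor of the site `a`
becomes the tensor factor of the site `e a`. For a permutation `e` of `ι` this is the conjugation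
`P M P†` by the unitary `P` that permutes the tensor factors. -/
def relabel {ι κ : Type*} {d : ℕ} (e : ι ≃ κ) (M : LocalOp ι d) : LocalOp κ d :=
  M.submatrix (fun i => i ∘ e) (fun j => j ∘ e)

/-- The basis index of the sites in `B` that is `i` on `C` and `k` on `B \ C`. -/
def glue {A : Type*} [DecidableEq A] {B C : Finset A} {d : ℕ}
    (i : C → Fin d) (k : (B \ C : Finset A) → Fin d) : B → Fin d :=
  fun b => if h : b.1 ∈ C then i ⟨b.1, h⟩ else k ⟨b.1, Finset.mem_sdiff.mpr ⟨b.2, h⟩⟩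

/-- The partial trace `tr_{B \ C}`, from operators on the sites `B` to operators on the sites
`C` (used for `C ⊆ B`). -/
def partialTrace {A : Type*} [DecidableEq A] {B : Finset A} (C : Finset A) {d : ℕ}
    (M : LocalOp B d) : LocalOp C d :=
  Matrix.of fun i j => ∑ k : (B \ C : Finset A) → Fin d, M (glue i k) (glue j k)

/-- A quantum state of a (possibly infinite) set `A` of `d`-dimensional systems: a compatible
family of density matrices, one for each finite set of sites. -/
structure QuantumState (A : Type*) [DecidableEq A] (d : ℕ) where
  /-- the reduced density matrix of a finite set of sites -/
  marginal : (B : Finset A) → LocalOp B d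
  isDensityMatrix : ∀ B, IsDensityMatrix (marginal B)
  compatible : ∀ B C : Finset A, C ⊆ B → partialTrace C (marginal B) = marginal C

/-- A state of `A` is separable if all of its finite marginals are. -/
def QuantumState.Separable {A : Type*} [DecidableEq A] {d : ℕ} (ρ : QuantumState A d) : Prop :=
  ∀ B : Finset A, IsFullySeparable (ρ.marginal B)

/-- The bijection from the finite set `B` of sites onto its image `g(B)` given by `a ↦ g a`. -/
def mapSites {A : Type*} (g : Equiv.Perm A) (B : Finset A) : B ≃ (B.map g.toEmbedding : Finset A) :=
  g.subtypeEquiv fun a => by simp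

/-- Invariance of a state under a permutation `g` of the sites: for every finite set `B` of
sites, the marginal of `g(B)` is the marginal of `B` moved along `g`. -/
def QuantumState.InvariantUnder {A : Type*} [DecidableEq A] {d : ℕ} (ρ : QuantumState A d)
    (g : Equiv.Perm A) : Prop :=
  ∀ B : Finset A,
    relabel (mapSites g B) (ρ.marginal B) = ρ.marginal (B.map g.toEmbedding)

/-- The sites of the hypercubic lattice `ℤ^D`. -/
abbrev Site (D : ℕ) : Type := Fin D → ℤ

/-- The reflection `x_k ↦ c - x_k` of the `k`-th axis, with mirror hyperplane `x_k = c / 2`. -/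
def latticeReflection {D : ℕ} (k : Fin D) (c : ℤ) : Equiv.Perm (Site D) where
  toFun x := Function.update x k (c - x k)
  invFun x := Function.update x k (c - x k)
  left_inv x := by simp
  right_inv x := by simp

/-- Translation invariance of a state of `ℤ^D`. -/
def TranslationInvariant {D d : ℕ} (ρ : QuantumState (Site D) d) : Prop :=
  ∀ z : Site D, ρ.InvariantUnder (Equiv.addRight z)

/-- Reflection invariance of a state of `ℤ^D`: invariance under the reflections of every axis,
through lattice sites (`c` even) and between lattice sites (`c` odd). -/
def ReflectionInvariant {D d : ℕ} (ρ : QuantumState (Site D) d) : Prop :=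
  ∀ (k : Fin D) (c : ℤ), ρ.InvariantUnder (latticeReflection k c)

/-- The plaquette `{1,2}^D`. -/
def plaquette (D : ℕ) : Finset (Site D) := Fintype.piFinset fun _ => {1, 2}

theorem latticeReflection_mem_plaquette {D : ℕ} (k : Fin D) (x : Site D) :
    latticeReflection k 3 x ∈ plaquette D ↔ x ∈ plaquette D := by
  have key : ∀ y : Site D, y ∈ plaquette D → latticeReflection k 3 y ∈ plaquette D := by
    intro y hy
    simp only [plaquette, Fintype.mem_piFinset, Finset.mem_insert, Finset.mem_singleton] at hy ⊢
    intro l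
    by_cases h : l = k
    · subst h
      have := hy l
      simp only [latticeReflection, Equiv.coe_fn_mk, Function.update_self]
      omega
    · simpa [latticeReflection, Function.update_of_ne h] using hy l
  refine ⟨fun h => ?_, key x⟩
  have h2 := key _ h
  simpa [latticeReflection] using h2

/-- The reflection of the `k`-th axis of the plaquette, which exchanges `x_k = 1` with
`x_k = 2`. -/
def plaquetteReflection {D : ℕ} (k : Fin D) : Equiv.Perm (plaquette D) :=
  (latticeReflection k 3).subtypePerm (latticeReflection_mem_plaquette k)

/-!
A separable invariant state restricts to a separable marginal, and the reflections `x_k ↦ 3 - x_k`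
of the lattice preserve the plaquette, so its marginal is invariant under them.

For the converse, let `ρhat` be the mixture, with law `p`, of the product states of families `φ` on
the plaquette. The lattice folds onto the plaquette along mirrors through lattice sites: in every
coordinate, odd numbers go to `1` and even numbers to `2`. Every family `φ` then unfolds to the
family `x ↦ φ (fold x)` on `ℤ^D`. As `p` itself need not be reflection invariant, the fold is
preceded by a shift `s`, uniform in `(ℤ/2)^D` (`foldSite`, `unfoldMeasure`).

The fold sees only the parities of the coordinates, and translations and reflections act on parities
as shifts. They therefore preserve the law of the unfolded family (`map_unfoldMeasure`), and with it
the mixture of the corresponding infinite product states (`QuantumState.ofMeasure`,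
`QuantumState.invariantUnder_ofMeasure`), which is separable by construction. On the plaquette, the
fold with shift `s` is the composition of the reflections of the axes with `s k = 1`. These fix
`ρhat`, so each shift contributes the marginal `ρhat`, and so does their average
(`marginal_plaquette_unfoldMeasure`).
-/

open MeasureTheory

/-! ### Product projectors -/

section ProductProjector

variable {ι κ : Type*} [Fintype ι] [Fintype κ] {d : ℕ}

theorem productProjector_apply (φ : ι → PureState d) (i j : ι → Fin d) :
    productProjector φ i j = ∏ a, (φ a : EuclideanSpace ℂ (Fin d)) (i a) *
      star ((φ a : EuclideanSpace ℂ (Fin d)) (j a)) := rfl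

theorem productProjector_comp_equiv (e : ι ≃ κ) (φ : κ → PureState d) (i j : κ → Fin d) :
    productProjector (φ ∘ e) (i ∘ e) (j ∘ e) = productProjector φ i j := by
  simp only [productProjector_apply, Function.comp_apply]
  exact e.prod_comp fun b => (φ b : EuclideanSpace ℂ (Fin d)) (i b) *
    star ((φ b : EuclideanSpace ℂ (Fin d)) (j b))

theorem sum_mul_star_pureState (v : PureState d) :
    ∑ x, (v : EuclideanSpace ℂ (Fin d)) x * star ((v : EuclideanSpace ℂ (Fin d)) x) = 1 := by
  have h : ‖(v : EuclideanSpace ℂ (Fin d))‖ ^ 2 = 1 := by simp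
  rw [EuclideanSpace.norm_sq_eq] at h
  have h2 : ((∑ x, ‖(v : EuclideanSpace ℂ (Fin d)) x‖ ^ 2 : ℝ) : ℂ) = 1 := by rw [h]; simp
  rw [← h2, Complex.ofReal_sum]
  refine Finset.sum_congr rfl fun x _ => ?_
  rw [Complex.star_def, Complex.mul_conj, Complex.normSq_eq_norm_sq]

theorem sum_productProjector_diag [DecidableEq ι] (φ : ι → PureState d) :
    ∑ k : ι → Fin d, productProjector φ k k = 1 := by
  simp only [productProjector_apply]
  rw [← Fintype.prod_sum fun a x => (φ a : EuclideanSpace ℂ (Fin d)) x *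
    star ((φ a : EuclideanSpace ℂ (Fin d)) x)]
  exact Finset.prod_eq_one fun a _ => sum_mul_star_pureState (φ a)

theorem productProjector_eq_vecMulVec (φ : ι → PureState d) :
    productProjector φ =
      Matrix.vecMulVec (fun i : ι → Fin d => ∏ a, (φ a : EuclideanSpace ℂ (Fin d)) (i a))
        (star fun i : ι → Fin d => ∏ a, (φ a : EuclideanSpace ℂ (Fin d)) (i a)) := by
  ext i j
  simp [productProjector_apply, Matrix.vecMulVec_apply, Finset.prod_mul_distrib]

theorem posSemidef_productProjector (φ : ι → PureState d) : (productProjector φ).PosSemidef := by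
  rw [productProjector_eq_vecMulVec]
  exact Matrix.posSemidef_vecMulVec_self_star _

theorem norm_productProjector_le (φ : ι → PureState d) (i j : ι → Fin d) :
    ‖productProjector φ i j‖ ≤ 1 := by
  have h : ∀ a x, ‖(φ a : EuclideanSpace ℂ (Fin d)) x‖ ≤ 1 := fun a x =>
    (PiLp.norm_apply_le _ x).trans (by simp)
  rw [productProjector_apply, norm_prod]
  refine Finset.prod_le_one (fun _ _ => norm_nonneg _) fun a _ => ?_
  rw [norm_mul, norm_star]
  exact mul_le_one₀ (h a _) (norm_nonneg _) (h a _)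

theorem measurable_productProjector (i j : ι → Fin d) :
    Measurable fun φ : ι → PureState d => productProjector φ i j := by
  have h : ∀ (a : ι) (x : Fin d),
      Measurable fun φ : ι → PureState d => (φ a : EuclideanSpace ℂ (Fin d)) x := fun a x =>
    (EuclideanSpace.proj (𝕜 := ℂ) x).continuous.measurable.comp
      (measurable_subtype_coe.comp (measurable_pi_apply a))
  simp only [productProjector_apply]
  refine Finset.measurable_prod _ fun a _ => (h a _).mul ?_
  exact continuous_star.measurable.comp (h a _)

theorem integrable_productProjector {Ω : Type*} [MeasurableSpace Ω] (P : Measure Ω)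
    [IsFiniteMeasure P] {f : Ω → ι → PureState d} (hf : Measurable f) (i j : ι → Fin d) :
    Integrable (fun ω => productProjector (f ω) i j) P :=
  Integrable.of_bound ((measurable_productProjector i j).comp hf).aestronglyMeasurable 1
    (Filter.Eventually.of_forall fun ω => norm_productProjector_le (f ω) i j)

/-- An entrywise mixture of positive semidefinite matrices is positive semidefinite. -/
theorem posSemidef_integral {n Ω : Type*} [Fintype n] [MeasurableSpace Ω] {P : Measure Ω}
    {M : Ω → Matrix n n ℂ} (hM : ∀ ω, (M ω).PosSemidef)
    (hint : ∀ i j, Integrable (fun ω => M ω i j) P) :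
    (Matrix.of fun i j => ∫ ω, M ω i j ∂P).PosSemidef := by
  refine Matrix.PosSemidef.of_dotProduct_mulVec_nonneg ?_ fun x => ?_
  · ext i j
    simp only [Matrix.conjTranspose_apply, Matrix.of_apply]
    rw [Complex.star_def, ← integral_conj]
    exact integral_congr_ae (Filter.Eventually.of_forall fun ω => (hM ω).1.apply i j)
  · have h : star x ⬝ᵥ (Matrix.of fun i j => ∫ ω, M ω i j ∂P).mulVec x =
        ∫ ω, star x ⬝ᵥ (M ω).mulVec x ∂P := by
      simp only [dotProduct, Matrix.mulVec, Matrix.of_apply]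
      rw [integral_finsetSum _ fun i _ => ((integrable_finsetSum _ fun j _ =>
        (hint i j).mul_const (x j)).const_mul _)]
      refine Finset.sum_congr rfl fun i _ => ?_
      rw [integral_const_mul, integral_finsetSum _ fun j _ => (hint i j).mul_const (x j)]
      simp only [integral_mul_const]
    rw [h]
    exact integral_nonneg fun ω => (hM ω).dotProduct_mulVec_nonneg x

/-- Tracing out unit vectors leaves the projector of the remaining ones. -/
theorem partialTrace_productProjector {A : Type*} [DecidableEq A] {B C : Finset A} (hCB : C ⊆ B)
    (φ : A → PureState d) :
    partialTrace C (productProjector fun b : B => φ b) = productProjector fun c : C => φ c := by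
  ext i j
  have hsplit : ∀ k : (B \ C : Finset A) → Fin d,
      productProjector (fun b : B => φ b) (glue i k) (glue j k) =
        productProjector (fun c : C => φ c) i j *
          productProjector (fun b : (B \ C : Finset A) => φ b) k k := by
    intro k
    let e : (C ⊕ (B \ C : Finset A)) ≃ B :=
      { toFun := Sum.elim (fun c => ⟨c, hCB c.2⟩) fun b => ⟨b, (Finset.mem_sdiff.mp b.2).1⟩
        invFun := fun b => if h : b.1 ∈ C then .inl ⟨b, h⟩ else
          .inr ⟨b, Finset.mem_sdiff.mpr ⟨b.2, h⟩⟩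
        left_inv := by
          rintro (c | b)
          · simp
          · simp [(Finset.mem_sdiff.mp b.2).2]
        right_inv := by
          intro b
          by_cases h : b.1 ∈ C <;> simp [h] }
    rw [← productProjector_comp_equiv e]
    simp only [productProjector_apply, Fintype.prod_sum_type]
    congr 1
    · refine Finset.prod_congr rfl fun c _ => ?_
      simp [e, glue]
    · refine Finset.prod_congr rfl fun b _ => ?_
      simp [e, glue, (Finset.mem_sdiff.mp b.2).2]
  simp only [partialTrace, Matrix.of_apply, hsplit]
  rw [← Finset.mul_sum, sum_productProjector_diag, mul_one]

end ProductProjector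

/-! ### Mixtures of infinite product states -/

section Mixtures

variable {A : Type*} {d : ℕ}

theorem measurable_restrict_sites (B : Finset A) :
    Measurable fun (φ : A → PureState d) (b : B) => φ b :=
  measurable_pi_lambda _ fun b => measurable_pi_apply (b : A)

theorem measurable_productProjector_restrict (B : Finset A) (i j : B → Fin d) :
    Measurable fun φ : A → PureState d => productProjector (fun b : B => φ b) i j :=
  (measurable_productProjector i j).comp (measurable_restrict_sites B)

theorem measurable_comp_sites {I J : Type*} (f : I → J) :
    Measurable fun φ : J → PureState d => φ ∘ f :=
  measurable_pi_lambda _ fun a => measurable_pi_apply (f a)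

theorem integrable_productProjector_restrict (P : Measure (A → PureState d)) [IsFiniteMeasure P]
    (B : Finset A) (i j : B → Fin d) :
    Integrable (fun φ => productProjector (fun b : B => φ b) i j) P :=
  integrable_productProjector P (measurable_restrict_sites B) i j

variable [DecidableEq A]

/-- The mixture, with mixing law `P`, of the infinite product states `⨂_{a ∈ A} |φ_a⟩⟨φ_a|`. -/
noncomputable def QuantumState.ofMeasure (P : Measure (A → PureState d))
    [IsProbabilityMeasure P] : QuantumState A d where
  marginal B := Matrix.of fun i j => ∫ φ, productProjector (fun b : B => φ b) i j ∂P
  isDensityMatrix B := by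
    refine ⟨posSemidef_integral (fun φ => posSemidef_productProjector _)
      (integrable_productProjector_restrict P B), ?_⟩
    simp only [Matrix.trace, Matrix.diag_apply, Matrix.of_apply]
    rw [← integral_finsetSum _ fun i _ => integrable_productProjector_restrict P B i i]
    simp [sum_productProjector_diag]
  compatible B C hCB := by
    ext i j
    simp only [partialTrace, Matrix.of_apply]
    rw [← integral_finsetSum _ fun k _ => integrable_productProjector_restrict P B _ _]
    refine integral_congr_ae (Filter.Eventually.of_forall fun φ => ?_)
    exact congr_fun₂ (partialTrace_productProjector hCB φ) i j

variable (P : Measure (A → PureState d)) [IsProbabilityMeasure P]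

theorem QuantumState.ofMeasure_marginal_apply (B : Finset A) (i j : B → Fin d) :
    (QuantumState.ofMeasure P).marginal B i j =
      ∫ φ, productProjector (fun b : B => φ b) i j ∂P := rfl

theorem QuantumState.separable_ofMeasure : (QuantumState.ofMeasure P).Separable := fun B =>
  ⟨P.map fun φ b => φ b, Measure.isProbabilityMeasure_map (measurable_restrict_sites B).aemeasurable,
    fun i j => by
      rw [integral_map (measurable_restrict_sites B).aemeasurable
        (measurable_productProjector i j).aestronglyMeasurable]
      rfl⟩

theorem QuantumState.invariantUnder_ofMeasure (g : Equiv.Perm A)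
    (hP : P.map (fun φ => φ ∘ g) = P) : (QuantumState.ofMeasure P).InvariantUnder g := by
  intro B
  ext i j
  simp only [relabel, Matrix.submatrix_apply, ofMeasure_marginal_apply]
  conv_lhs => rw [← hP]
  rw [integral_map (measurable_comp_sites g).aemeasurable
    (measurable_productProjector_restrict B _ _).aestronglyMeasurable]
  refine integral_congr_ae (Filter.Eventually.of_forall fun φ => ?_)
  exact productProjector_comp_equiv (mapSites g B) (fun b => φ b) i j

/-- Invariance under a permutation that maps `B` onto itself, read on the marginal of `B`. -/
theorem QuantumState.InvariantUnder.marginal_apply {ρ : QuantumState A d} {g : Equiv.Perm A}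
    (h : ρ.InvariantUnder g) {B : Finset A} (hB : ∀ a, g a ∈ B ↔ a ∈ B) (i j : B → Fin d) :
    ρ.marginal B (i ∘ g.subtypePerm hB) (j ∘ g.subtypePerm hB) = ρ.marginal B i j := by
  have hmap : B.map g.toEmbedding = B := by
    ext a
    rw [Finset.mem_map_equiv, ← hB, g.apply_symm_apply]
  -- Equality of the index sets is a cast on matrices; it is handled for an arbitrary equal set.
  have hcast : ∀ (B' : Finset A) (e : B' = B),
      ρ.marginal B' (fun b => i ⟨b, e ▸ b.2⟩) (fun b => j ⟨b, e ▸ b.2⟩) = ρ.marginal B i j := by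
    rintro _ rfl
    rfl
  rw [← hcast _ hmap, ← h B]
  rfl

end Mixtures

/-! ### Folding the lattice onto the plaquette -/

section Folding

variable {D d : ℕ}

/-- The map `ℤ^D → {1,2}^D` that folds the lattice onto the plaquette along mirrors through
lattice sites, after a shift by `s`: the image of `x` has the parity of `x + s`. -/
def foldSite (s : Fin D → ZMod 2) (x : Site D) : plaquette D :=
  ⟨fun k => if (x k : ZMod 2) + s k = 1 then 1 else 2, by
    simp only [plaquette, Fintype.mem_piFinset, Finset.mem_insert, Finset.mem_singleton]
    intro k
    split <;> simp⟩

theorem foldSite_cast (s : Fin D → ZMod 2) (x : Site D) (k : Fin D) :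
    (((foldSite s x).1 k : ℤ) : ZMod 2) = x k + s k := by
  have h : ∀ a : ZMod 2, (((if a = 1 then 1 else 2 : ℤ)) : ZMod 2) = a := by decide
  exact h _

theorem foldSite_eq_of_parity {s t : Fin D → ZMod 2} {x y : Site D}
    (h : ∀ k, (x k : ZMod 2) + s k = y k + t k) : foldSite s x = foldSite t y := by
  ext k
  simp only [foldSite, h]

theorem foldSite_zero (y : plaquette D) : foldSite 0 (y : Site D) = y := by
  ext k
  have hy := y.2
  simp only [plaquette, Fintype.mem_piFinset, Finset.mem_insert, Finset.mem_singleton] at hy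
  have h2 : ((2 : ℤ) : ZMod 2) = 0 := by decide
  rcases hy k with h | h <;> simp [foldSite, h]
  decide

theorem foldSite_foldSite (s t : Fin D → ZMod 2) (x : Site D) :
    foldSite s (foldSite t x : Site D) = foldSite (s + t) x :=
  foldSite_eq_of_parity fun k => by rw [foldSite_cast, Pi.add_apply]; ring

theorem latticeReflection_cast (k : Fin D) (c : ℤ) (x : Site D) (l : Fin D) :
    ((latticeReflection k c x l : ℤ) : ZMod 2) = x l + (Pi.single k (c : ZMod 2) : _ → ZMod 2) l := by
  by_cases h : l = k
  · subst h
    simp only [latticeReflection, Equiv.coe_fn_mk, Function.update_self, Pi.single_eq_same]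
    push_cast
    rw [CharTwo.sub_eq_add, add_comm]
  · simp [latticeReflection, h]

theorem foldSite_single_one (k : Fin D) (y : plaquette D) :
    foldSite (Pi.single k 1) (y : Site D) = plaquetteReflection k y := by
  rw [← foldSite_zero (plaquetteReflection k y)]
  refine foldSite_eq_of_parity fun l => ?_
  have h := latticeReflection_cast k 3 (y : Site D) l
  have h3 : ((3 : ℤ) : ZMod 2) = 1 := by decide
  rw [h3] at h
  rw [← h, Pi.zero_apply, add_zero]
  rfl

theorem parity_add_self (s : Fin D → ZMod 2) : s + s = 0 :=
  funext fun k => CharTwo.add_self_eq_zero (s k)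

/-- The permutation of the plaquette induced by `foldSite s`: the composition of the reflections
of the axes `k` with `s k = 1`. -/
def foldPerm (s : Fin D → ZMod 2) : Equiv.Perm (plaquette D) :=
  Function.Involutive.toPerm (fun y => foldSite s (y : Site D)) fun y => by
    simp only [foldSite_foldSite, parity_add_self, foldSite_zero]

theorem foldPerm_apply (s : Fin D → ZMod 2) (y : plaquette D) :
    foldPerm s y = foldSite s (y : Site D) := rfl

theorem foldPerm_add (s t : Fin D → ZMod 2) : foldPerm (s + t) = foldPerm s * foldPerm t := by
  ext1 y
  simp only [Equiv.Perm.mul_apply, foldPerm_apply, foldSite_foldSite]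

theorem foldPerm_single_one (k : Fin D) : foldPerm (Pi.single k 1) = plaquetteReflection k :=
  Equiv.ext (foldSite_single_one k)

theorem relabel_mul {ι : Type*} (e f : Equiv.Perm ι) (M : LocalOp ι d) :
    relabel (e * f) M = relabel e (relabel f M) := rfl

theorem relabel_foldPerm {M : LocalOp (plaquette D) d}
    (hM : ∀ k, relabel (plaquetteReflection k) M = M) (s : Fin D → ZMod 2) :
    relabel (foldPerm s) M = M := by
  have h0 : relabel (foldPerm 0) M = M := by
    have : foldPerm (0 : Fin D → ZMod 2) = Equiv.refl _ := Equiv.ext foldSite_zero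
    rw [this]
    rfl
  have hbit : ∀ a : ZMod 2, a = 0 ∨ a = 1 := by decide
  rw [← Finset.univ_sum_single s]
  refine Finset.sum_induction _ (fun t => relabel (foldPerm t) M = M) (fun t u ht hu => ?_) h0
    fun k _ => ?_
  · rw [foldPerm_add, relabel_mul, hu, ht]
  · rcases hbit (s k) with h | h
    · rw [h, Pi.single_zero, h0]
    · rw [h, foldPerm_single_one, hM]

/-- The law of the unfolded family `x ↦ φ (foldSite s x)`, where `φ` has law `p` and the shift `s`
is uniformly distributed and independent of `φ`. -/
noncomputable def unfoldMeasure (p : Measure (plaquette D → PureState d)) :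
    Measure (Site D → PureState d) :=
  (Fintype.card (Fin D → ZMod 2) : ENNReal)⁻¹ •
    ∑ s : Fin D → ZMod 2, p.map fun φ => φ ∘ foldSite s

variable (p : Measure (plaquette D → PureState d))

instance isProbabilityMeasure_unfoldMeasure [IsProbabilityMeasure p] :
    IsProbabilityMeasure (unfoldMeasure p) := by
  have h (s : Fin D → ZMod 2) : (p.map fun φ => φ ∘ foldSite s) Set.univ = 1 := by
    rw [Measure.map_apply (measurable_comp_sites _) .univ, Set.preimage_univ, measure_univ]
  refine ⟨?_⟩
  simp only [unfoldMeasure, Measure.smul_apply, Measure.finsetSum_apply, h, Finset.sum_const,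
    Finset.card_univ, nsmul_eq_mul, mul_one, smul_eq_mul]
  exact ENNReal.inv_mul_cancel (by simp) (by simp)

/-- A permutation of the lattice that acts on parities as a shift only changes the random shift
in the unfolded family, hence not its law. -/
theorem map_unfoldMeasure (g : Equiv.Perm (Site D)) (t : Fin D → ZMod 2)
    (hg : ∀ x k, ((g x k : ℤ) : ZMod 2) = x k + t k) :
    (unfoldMeasure p).map (fun φ => φ ∘ g) = unfoldMeasure p := by
  have hs (s : Fin D → ZMod 2) :
      (p.map fun φ => φ ∘ foldSite s).map (fun φ => φ ∘ g) =
        p.map fun φ => φ ∘ foldSite (s + t) := by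
    rw [Measure.map_map (measurable_comp_sites _) (measurable_comp_sites _)]
    congr 1
    funext φ x
    have : foldSite s (g x) = foldSite (s + t) x :=
      foldSite_eq_of_parity fun k => by rw [hg, Pi.add_apply]; ring
    simp only [Function.comp_apply, this]
  rw [unfoldMeasure, Measure.map_smul, ← Measure.mapₗ_apply_of_measurable (measurable_comp_sites _),
    map_sum]
  simp only [Measure.mapₗ_apply_of_measurable (measurable_comp_sites _), hs]
  congr 1
  exact Equiv.sum_comp (Equiv.addRight t) fun s => p.map fun φ => φ ∘ foldSite s

theorem marginal_plaquette_unfoldMeasure [IsProbabilityMeasure p] {M : LocalOp (plaquette D) d}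
    (hp : ∀ i j, M i j = ∫ φ, productProjector φ i j ∂p)
    (hM : ∀ k, relabel (plaquetteReflection k) M = M) :
    (QuantumState.ofMeasure (unfoldMeasure p)).marginal (plaquette D) = M := by
  ext i j
  have hs (s : Fin D → ZMod 2) :
      ∫ ψ, productProjector (fun b : plaquette D => ψ b) i j ∂(p.map fun φ => φ ∘ foldSite s) =
        M i j := by
    rw [integral_map (measurable_comp_sites _).aemeasurable
      (measurable_productProjector_restrict _ _ _).aestronglyMeasurable]
    conv_rhs => rw [← relabel_foldPerm hM s]
    simp only [relabel, Matrix.submatrix_apply, hp]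
    refine integral_congr_ae (Filter.Eventually.of_forall fun φ => ?_)
    have h := productProjector_comp_equiv (foldPerm s) (φ ∘ foldPerm s) i j
    have hinv : (φ ∘ foldPerm s) ∘ foldPerm s = φ := by
      funext y
      simp only [Function.comp_apply, ← Equiv.Perm.mul_apply, ← foldPerm_add,
        parity_add_self]
      exact congrArg φ (foldSite_zero y)
    rw [hinv] at h
    exact h.symm
  have hprob (s : Fin D → ZMod 2) : IsProbabilityMeasure (p.map fun φ => φ ∘ foldSite s) :=
    Measure.isProbabilityMeasure_map (measurable_comp_sites _).aemeasurable
  rw [QuantumState.ofMeasure_marginal_apply, unfoldMeasure, integral_smul_measure,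
    integral_finsetSum_measure fun s _ => integrable_productProjector_restrict _ _ i j]
  simp only [hs, Finset.sum_const, Finset.card_univ]
  rw [ENNReal.toReal_inv, ENNReal.toReal_natCast, ← Nat.cast_smul_eq_nsmul ℝ, smul_smul,
    inv_mul_cancel₀ (by simp), one_smul]

end Folding

/-! ### The marginal problem for a plaquette -/

theorem proposition3 (D d : ℕ) (ρhat : LocalOp (plaquette D) d) (hρ : IsDensityMatrix ρhat) :
    (∃ ρ : QuantumState (Site D) d,
        ρ.Separable ∧ TranslationInvariant ρ ∧ ReflectionInvariant ρ ∧
          ρ.marginal (plaquette D) = ρhat) ↔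
      IsFullySeparable ρhat ∧ ∀ k : Fin D, relabel (plaquetteReflection k) ρhat = ρhat := by
  constructor
  · rintro ⟨ρ, hsep, -, hrefl, rfl⟩
    refine ⟨hsep _, fun k => ?_⟩
    ext i j
    exact (hrefl k 3).marginal_apply (latticeReflection_mem_plaquette k) i j
  · rintro ⟨⟨p, hprob, hp⟩, hinv⟩
    refine ⟨QuantumState.ofMeasure (unfoldMeasure p), QuantumState.separable_ofMeasure _,
      fun z => ?_, fun k c => ?_, marginal_plaquette_unfoldMeasure p hp hinv⟩
    · refine QuantumState.invariantUnder_ofMeasure _ _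
        (map_unfoldMeasure p _ (fun k => (z k : ZMod 2)) fun x k => ?_)
      simp
    · exact QuantumState.invariantUnder_ofMeasure _ _
        (map_unfoldMeasure p _ (Pi.single k (c : ZMod 2)) (latticeReflection_cast k c))
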